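/- Let $p$ be a prime and let $F$ be a field which contains a primitive $p$-th root of unity if $p$ is odd, and a primitive fourth root of unity if $p=2$. Let $G_F(p)$ be the maximal pro-$p$ quotient of the absolute Galois group $\mathrm{Gal}(F_{sep}/F)$. Let $S$ be a free pro-$p$ group on a set of generators $\{x\}\cup\{y_i\mid i\in I\}$ (where $x$ and the $y_i$ are distinct; for infinite $I$ the generators converge to $1$, as usual), and let $$1\longrightarrow R\longrightarrow S\stackrel{\pi}{\longrightarrow} G_F(p)\longrightarrow 1$$ be a minimal presentation of $G_F(p)$, that is, $\pi$ is a continuous surjective homomorphism with kernel $R\subseteq S^p[S,S]$. For closed subgroups $H,K$ of $S$, let $[H,K]$ be the smallest closed subgroup containing all $[h,k]=hkh^{-1}k^{-1}$ with $h\in H$, $k\in K$, and let $H^p$ be the smallest closed subgroup containing all $h^p$ with $h\in H$. Let $S^{(1)}=S$ and $S^{(i+1)}=(S^{(i)})^p[S^{(i)},S]$ for $i\ge 1$ (the $p$-descending central series of $S$). Let $T$ be the closed subgroup of $S$ generated by $\{y_i\mid i\in I\}$. Then there is no relation $r\in R$ of the form $r=x^{p^{l-1}u}\,s\,t$, where $l$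 and $u$ are integers with $l\ge 2$ and $\gcd(p,u)=1$, $s\in[T,T]$ and $t\in S^{(l+1)}\cap[S,S]$. -/

import Mathlib

open Filter Topology

/-- The commutator `[H, K]` of two subgroups of a topological group: the smallest closed subgroup
containing all `x * y * x⁻¹ * y⁻¹` with `x ∈ H` and `y ∈ K`. -/
def closedCommutator {G : Type*} [Group G] [TopologicalSpace G] [IsTopologicalGroup G]
    (H K : Subgroup G) : Subgroup G :=
  (⁅H, K⁆).topologicalClosure

/-- The subgroup `H ^ p` of a topological group: the smallest closed subgroup containing all
`x ^ p` with `x ∈ H`. -/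
def closedPower {G : Type*} [Group G] [TopologicalSpace G] [IsTopologicalGroup G]
    (p : ℕ) (H : Subgroup G) : Subgroup G :=
  (Subgroup.closure {g : G | ∃ x ∈ H, g = x ^ p}).topologicalClosure

/-- The `p`-descending central series: `G^(1) = G` and `G^(i+1) = (G^(i))^p [G^(i), G]`.
(The value at the index `0`, which is not part of the series, is `G`.) -/
def pDescendingCentralSeries (p : ℕ) (G : Type*) [Group G] [TopologicalSpace G]
    [IsTopologicalGroup G] : ℕ → Subgroup G
  | 0 => ⊤
  | 1 => ⊤
  | i + 2 =>
    closedPower p (pDescendingCentralSeries p G (i + 1)) ⊔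
      closedCommutator (pDescendingCentralSeries p G (i + 1)) ⊤

/-- A topological group is a pro-`p` group if it is profinite and all its open normal subgroups
have index a power of `p`. -/
structure IsProPGroup (p : ℕ) (G : Type*) [Group G] [TopologicalSpace G]
    [IsTopologicalGroup G] : Prop where
  compactSpace : CompactSpace G
  t2Space : T2Space G
  totallyDisconnectedSpace : TotallyDisconnectedSpace G
  index_eq : ∀ N : Subgroup G, N.Normal → IsOpen (N : Set G) → ∃ n : ℕ, N.index = p ^ n

/-- A family of elements of a topological group converges to `1` if every neighbourhood of `1`
contains all but finitely many of its members. -/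
def ConvergesToOne {X G : Type*} [Group G] [TopologicalSpace G] (f : X → G) : Prop :=
  Tendsto f cofinite (𝓝 1)

universe u v

/-- `S` is a free pro-`p` group on the family `ι : X → S`: it is a pro-`p` group, the family
converges to `1`, and every family converging to `1` in a pro-`p` group `P`, indexed by `X`, is the
image of `ι` under exactly one continuous homomorphism `S → P`. -/
structure IsFreeProPGroupOn (p : ℕ) {S : Type v} [Group S] [TopologicalSpace S]
    [IsTopologicalGroup S] {X : Type u} (ι : X → S) : Prop where
  isProPGroup : IsProPGroup p S
  convergesToOne : ConvergesToOne ι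
  existsUnique_lift : ∀ (P : Type v) [Group P] [TopologicalSpace P] [IsTopologicalGroup P],
    IsProPGroup p P → ∀ f : X → P, ConvergesToOne f →
      ∃! φ : S →ₜ* P, ∀ a : X, φ (ι a) = f a

/-- The intersection of all open normal subgroups of `p`-power index. -/
def proPKernel (p : ℕ) (G : Type*) [Group G] [TopologicalSpace G] : Subgroup G :=
  sInf {N : Subgroup G | N.Normal ∧ IsOpen (N : Set G) ∧ ∃ n : ℕ, N.index = p ^ n}

instance proPKernel_normal (p : ℕ) (G : Type*) [Group G] [TopologicalSpace G] :
    (proPKernel p G).Normal := by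
  constructor
  intro g hg h
  rw [proPKernel, Subgroup.mem_sInf] at hg ⊢
  intro N hN
  exact hN.1.conj_mem g (hg N hN) h

/-- The maximal pro-`p` quotient of a profinite group, with the quotient topology. -/
abbrev MaximalProPQuotient (p : ℕ) (G : Type*) [Group G] [TopologicalSpace G] : Type _ :=
  G ⧸ proPKernel p G

/-- `G_F(p)`: the maximal pro-`p` quotient of the absolute Galois group of `F`. -/
abbrev maximalProPGaloisGroup (p : ℕ) (F : Type*) [Field F] : Type _ :=
  MaximalProPQuotient p (SeparableClosure F ≃ₐ[F] SeparableClosure F)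

/-- A continuous homomorphism `π : S → G` from a (free) pro-`p` group `S` is a minimal
presentation of `G` if it is surjective and its kernel lies in the Frattini subgroup
`S^p [S, S]` of `S`. -/
structure IsMinimalPresentation (p : ℕ) {S G : Type*} [Group S] [TopologicalSpace S]
    [IsTopologicalGroup S] [Group G] [TopologicalSpace G] (π : S →ₜ* G) : Prop where
  surjective : Function.Surjective π
  ker_le : π.toMonoidHom.ker ≤ closedPower p (⊤ : Subgroup S) ⊔ closedCommutator ⊤ ⊤

/-- The standing assumption on the roots of unity in the base field: a primitive `p`-th root of
unity if `p` is odd, a primitive fourth root of unity if `p = 2`. -/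
def RootsOfUnityCondition (p : ℕ) (F : Type*) [Field F] : Prop :=
  (p ≠ 2 → ∃ ζ : F, IsPrimitiveRoot ζ p) ∧ (p = 2 → ∃ ζ : F, IsPrimitiveRoot ζ 4)

/-! Let `c` be the cyclotomic character modulo `p ^ l`, and write crossed homomorphisms into
`ℤ/p^l(1)` as homomorphisms into affine maps of `ZMod (p ^ l)` with linear part `c`.

By Kummer theory every character `G_F(p) → ℤ/p` lifts to such a crossed homomorphism: adjoin a `p ^
(l - 1)`-th root of its radical (`liftsCharacters_autToPow`). Minimality of `π` says that `S` and
`G_F(p)` have the same characters to `ℤ/p`, so a `p`-adic approximation shows that every crossed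
homomorphism on `S` factors through `π` and vanishes on `R` (`LiftsCharacters.shift_eq_zero`).

On a free group a crossed homomorphism may be prescribed on generators; take `1` on `x` and `0` on
each `y i`. It vanishes on `[T,T]`, and on `S^(l+1)` because each step of the series gains a factor
`p`. Hence it would vanish on `x ^ (p ^ (l - 1) * u)`. But its value on `x ^ p ^ (l - 1)` is `p ^ (l
- 1)` times a unit, nonzero modulo `p ^ l`; this is where `c ≡ 1` modulo `p`, or modulo `4` if `p =
2`, enters. -/

/-! ### The affine congruence group and its `p`-adic filtration. -/

/-- The affine maps `z ↦ scale * z + shift` of a commutative ring `A` whose scale is congruent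
to `1` modulo `q`. -/
@[ext] structure CongruenceAffine (A : Type*) [CommRing A] (q : A) where
  shift : A
  scale : Aˣ
  dvd_scale_sub_one : q ∣ (scale : A) - 1

namespace CongruenceAffine

variable {A : Type*} [CommRing A] {q : A}

theorem dvd_mul_sub_one {q a b : A} (ha : q ∣ a - 1) (hb : q ∣ b - 1) : q ∣ a * b - 1 := by
  have := dvd_add (ha.mul_right b) hb
  rwa [show (a - 1) * b + (b - 1) = a * b - 1 by ring] at this

theorem dvd_inv_sub_one {q : A} {a : Aˣ} (ha : q ∣ (a : A) - 1) : q ∣ ((a⁻¹ : Aˣ) : A) - 1 := by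
  have := (ha.mul_left (-((a⁻¹ : Aˣ) : A)))
  rwa [show -((a⁻¹ : Aˣ) : A) * (a - 1) = ((a⁻¹ : Aˣ) : A) - (a⁻¹ : Aˣ) * a by ring,
    Units.inv_mul] at this

instance : Mul (CongruenceAffine A q) :=
  ⟨fun g h => ⟨g.shift + g.scale * h.shift, g.scale * h.scale, by
    push_cast; exact dvd_mul_sub_one g.3 h.3⟩⟩

instance : One (CongruenceAffine A q) := ⟨⟨0, 1, by simp⟩⟩

instance : Inv (CongruenceAffine A q) :=
  ⟨fun g => ⟨-(((g.scale⁻¹ : Aˣ) : A) * g.shift), g.scale⁻¹, dvd_inv_sub_one g.3⟩⟩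

@[simp] theorem shift_mul (g h : CongruenceAffine A q) :
    (g * h).shift = g.shift + g.scale * h.shift := rfl
@[simp] theorem scale_mul (g h : CongruenceAffine A q) :
    (g * h).scale = g.scale * h.scale := rfl
@[simp] theorem shift_one : (1 : CongruenceAffine A q).shift = 0 := rfl
@[simp] theorem scale_one : (1 : CongruenceAffine A q).scale = 1 := rfl
@[simp] theorem shift_inv (g : CongruenceAffine A q) :
    (g⁻¹).shift = -(((g.scale⁻¹ : Aˣ) : A) * g.shift) := rfl
@[simp] theorem scale_inv (g : CongruenceAffine A q) : (g⁻¹).scale = g.scale⁻¹ := rfl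

instance : Group (CongruenceAffine A q) :=
  Group.ofLeftAxioms
    (fun a b c => by ext <;> simp <;> ring)
    (fun a => by ext <;> simp)
    (fun a => by ext <;> simp)

instance [Finite A] : Finite (CongruenceAffine A q) :=
  Finite.of_injective (fun g => (g.shift, g.scale)) fun g h e => by
    ext
    · exact congrArg Prod.fst e
    · exact congrArg (fun z => ((Prod.snd z : Aˣ) : A)) e

/-- The linear part of an affine map. -/
def scaleHom (A : Type*) [CommRing A] (q : A) : CongruenceAffine A q →* Aˣ where
  toFun := scale
  map_one' := rfl
  map_mul' _ _ := rfl

@[simp] theorem scaleHom_apply (g : CongruenceAffine A q) : scaleHom A q g = g.scale := rfl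

@[simp] theorem scale_pow (g : CongruenceAffine A q) (n : ℕ) : (g ^ n).scale = g.scale ^ n :=
  map_pow (scaleHom A q) g n

theorem shift_pow (g : CongruenceAffine A q) (n : ℕ) :
    (g ^ n).shift = (∑ i ∈ Finset.range n, (g.scale : A) ^ i) * g.shift := by
  induction n with
  | zero => simp
  | succ n ih => rw [pow_succ, shift_mul, ih, Finset.sum_range_succ, scale_pow]; push_cast; ring

theorem isPGroup {p l : ℕ} (hp : (p : A) ^ l = 0) (hq : (p : A) ∣ q) :
    IsPGroup p (CongruenceAffine A q) := by
  intro g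
  -- A unit congruent to `1` modulo `p` has `p ^ l`-th power congruent to `1` modulo `p ^ (l + 1)`.
  -- What remains is a translation, killed by `p ^ l`.
  have h1 : (g ^ p ^ l).scale = 1 := by
    have := dvd_sub_pow_of_dvd_sub (hq.trans g.3) l
    rw [pow_succ, hp, zero_mul, zero_dvd_iff, one_pow, sub_eq_zero] at this
    ext; simpa using this
  refine ⟨l + l, ?_⟩
  rw [pow_add, pow_mul]
  ext
  · rw [shift_pow, h1]; simp [hp]
  · rw [scale_pow, h1]; simp

/-- The affine maps without translation part. -/
def linear (A : Type*) [CommRing A] (q : A) : Subgroup (CongruenceAffine A q) where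
  carrier := {g | g.shift = 0}
  mul_mem' {a b} ha hb := by
    simp only [Set.mem_ofPred_eq] at ha hb; simp [ha, hb]
  one_mem' := rfl
  inv_mem' {a} ha := by
    simp only [Set.mem_ofPred_eq] at ha; simp [ha]

/-- The affine maps with translation part divisible by `p ^ i` and linear part congruent to `1`
modulo `p ^ (i + 1)`. -/
def level (A : Type*) [CommRing A] (q : A) (p i : ℕ) : Subgroup (CongruenceAffine A q) where
  carrier := {g | (p : A) ^ i ∣ g.shift ∧ (p : A) ^ (i + 1) ∣ g.scale - 1}
  mul_mem' {a b} ha hb := by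
    refine ⟨dvd_add ha.1 (hb.1.mul_left _), ?_⟩
    rw [scale_mul]; push_cast; exact dvd_mul_sub_one ha.2 hb.2
  one_mem' := by simp
  inv_mem' {a} ha := ⟨(ha.1.mul_left _).neg_right, dvd_inv_sub_one ha.2⟩

theorem mem_level {p i : ℕ} {g : CongruenceAffine A q} :
    g ∈ level A q p i ↔ (p : A) ^ i ∣ g.shift ∧ (p : A) ^ (i + 1) ∣ (g.scale : A) - 1 := Iff.rfl

theorem level_zero {p : ℕ} (hq : (p : A) ∣ q) : level A q p 0 = ⊤ := by
  ext g; simpa [mem_level] using hq.trans g.3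

theorem dvd_geom_sum {p : ℕ} {c : A} (hc : (p : A) ∣ c - 1) :
    (p : A) ∣ ∑ i ∈ Finset.range p, c ^ i := by
  have h : ∑ i ∈ Finset.range p, c ^ i = ∑ i ∈ Finset.range p, (c ^ i - 1) + p := by simp
  rw [h]
  exact dvd_add (Finset.dvd_sum fun i _ => hc.trans (sub_one_dvd_pow_sub_one c i)) dvd_rfl

theorem pow_mem_level {p i : ℕ} {g : CongruenceAffine A q} (hg : g ∈ level A q p i) :
    g ^ p ∈ level A q p (i + 1) := by
  have h := dvd_geom_sum ((dvd_pow_self (p : A) i.succ_ne_zero).trans hg.2)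
  refine ⟨?_, ?_⟩
  · rw [shift_pow, pow_succ']
    exact mul_dvd_mul h hg.1
  · rw [scale_pow, Units.val_pow_eq_pow_val, ← mul_geom_sum, pow_succ]
    exact mul_dvd_mul hg.2 h

-- The commutator is translation by `(g.scale - 1) * h.shift - (h.scale - 1) * g.shift`. The first
-- term forces the linear part in `level` to be one power of `p` ahead of the shift.
open scoped commutatorElement in
theorem commutator_mem_level {p i : ℕ} (hq : (p : A) ∣ q) {g : CongruenceAffine A q}
    (hg : g ∈ level A q p i) (h : CongruenceAffine A q) : ⁅g, h⁆ ∈ level A q p (i + 1) := by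
  have hs : (⁅g, h⁆ : CongruenceAffine A q).scale = 1 := by
    simp [commutatorElement_def]
  refine ⟨?_, by simp [hs]⟩
  have e : ⁅g, h⁆ * (h * g) = g * h := by simp [commutatorElement_def, mul_assoc]
  have e' := congrArg shift e
  rw [shift_mul, hs, shift_mul, shift_mul] at e'
  have : (⁅g, h⁆ : CongruenceAffine A q).shift =
      (g.scale - 1) * h.shift - (h.scale - 1) * g.shift := by
    push_cast at e'
    linear_combination e'
  rw [this]
  refine dvd_sub (hg.2.mul_right _) ?_
  rw [pow_succ']
  exact mul_dvd_mul (hq.trans h.3) hg.1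

/-- The first terms of the geometric series of ratio `c ≡ 1` modulo `p` (modulo `4` if `p = 2`). -/
theorem exists_geom_sum_eq {p : ℕ} (h : (Odd p ∧ (p : A) ∣ q) ∨ (p = 2 ∧ 4 ∣ q)) {c : A}
    (hc : q ∣ c - 1) : ∃ e : A, ∑ i ∈ Finset.range p, c ^ i = p * (1 + p * e) := by
  rcases h with ⟨hp, hq⟩ | ⟨rfl, hq⟩
  · obtain ⟨d, hd⟩ := hq.trans hc
    -- Modulo `p ^ 2` the sum is `p + p * d * (p * (p - 1) / 2)`, and `p` divides the last factor
    -- because `p` is odd.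
    obtain ⟨e, he⟩ := odd_sq_dvd_geom_sum₂_sub (R := A) (a := 1) (b := d) hp
    refine ⟨e, ?_⟩
    rw [eq_add_of_sub_eq hd]
    simp only [one_pow, mul_one] at he
    rw [add_comm, eq_add_of_sub_eq he]
    ring
  -- The sum is `1 + c = 2 * (1 + 2 * d)`. Congruence modulo `2` would not do: `c = -1` gives `0`.
  · obtain ⟨d, hd⟩ := hq.trans hc
    refine ⟨d, ?_⟩
    rw [eq_add_of_sub_eq hd]
    simp [Finset.sum_range_succ]
    ring

/-- Each `p`-th power multiplies the shift by a geometric sum, which is `p` times something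
congruent to `1` modulo `p`. So no power of `p` beyond `p ^ m` is gained. -/
theorem exists_shift_pow_eq {p : ℕ} (h : (Odd p ∧ (p : A) ∣ q) ∨ (p = 2 ∧ 4 ∣ q))
    (g : CongruenceAffine A q) (m : ℕ) :
    ∃ e : A, (g ^ p ^ m).shift = p ^ m * (1 + p * e) * g.shift := by
  induction m with
  | zero => exact ⟨0, by simp⟩
  | succ m ih =>
    obtain ⟨e, he⟩ := ih
    obtain ⟨e', he'⟩ := exists_geom_sum_eq h (g ^ p ^ m).3
    refine ⟨e + e' + p * e * e', ?_⟩
    rw [pow_succ, pow_mul, shift_pow, he', he]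
    ring

end CongruenceAffine

/-! ### Locally constant homomorphisms and closed filtrations. -/

section TopologicalGroups

variable {G : Type*} [Group G] [TopologicalSpace G] [IsTopologicalGroup G]

theorem MonoidHom.isClosed_comap_of_isLocallyConstant {H : Type*} [Group H] {f : G →* H}
    (hf : IsLocallyConstant f) (K : Subgroup H) : IsClosed (K.comap f : Set G) :=
  Subgroup.isClosed_of_isOpen _ (hf K)

theorem MonoidHom.isLocallyConstant_of_isOpen_ker {H : Type*} [Group H] (f : G →* H)
    (hf : IsOpen (f.ker : Set G)) : IsLocallyConstant f := by
  rw [IsLocallyConstant.iff_exists_open]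
  intro g
  refine ⟨(fun h => g⁻¹ * h) ⁻¹' f.ker, hf.preimage (continuous_const_mul _), by simp, ?_⟩
  intro h hh
  have : f (g⁻¹ * h) = 1 := hh
  rw [map_mul, map_inv, inv_mul_eq_one] at this
  exact this.symm

theorem closedCommutator_le {H K L : Subgroup G} (hL : IsClosed (L : Set G)) (h : ⁅H, K⁆ ≤ L) :
    closedCommutator H K ≤ L :=
  Subgroup.topologicalClosure_minimal _ h hL

theorem closedPower_le {p : ℕ} {H L : Subgroup G} (hL : IsClosed (L : Set G))
    (h : ∀ g ∈ H, g ^ p ∈ L) : closedPower p H ≤ L :=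
  Subgroup.topologicalClosure_minimal _
    ((Subgroup.closure_le _).2 (by rintro _ ⟨g, hg, rfl⟩; exact h g hg)) hL

/-- A locally constant homomorphism to an elementary abelian `p`-group kills the Frattini
subgroup. -/
theorem frattini_le_ker {p : ℕ} {H : Type*} [CommGroup H] (hH : ∀ h : H, h ^ p = 1) {f : G →* H}
    (hf : IsLocallyConstant f) :
    closedPower p (⊤ : Subgroup G) ⊔ closedCommutator ⊤ ⊤ ≤ f.ker := by
  have hc : IsClosed (f.ker : Set G) := f.isClosed_comap_of_isLocallyConstant hf ⊥
  refine sup_le (closedPower_le hc fun g _ => ?_) (closedCommutator_le hc ?_)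
  · rw [MonoidHom.mem_ker, map_pow, hH]
  · exact Abelianization.commutator_subset_ker f

theorem pDescendingCentralSeries_le_level {p : ℕ} {A : Type*} [CommRing A] {q : A}
    (hq : (p : A) ∣ q) {f : G →* CongruenceAffine A q} (hf : IsLocallyConstant f) (i : ℕ) :
    pDescendingCentralSeries p G (i + 1) ≤ (CongruenceAffine.level A q p i).comap f := by
  induction i with
  | zero => rw [CongruenceAffine.level_zero hq]; exact le_top
  | succ i ih =>
    have hc := f.isClosed_comap_of_isLocallyConstant hf (CongruenceAffine.level A q p (i + 1))
    refine sup_le (closedPower_le hc fun g hg => ?_)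
      (closedCommutator_le hc (Subgroup.commutator_le.2 fun g hg h _ => ?_))
    · rw [Subgroup.mem_comap, map_pow]
      exact CongruenceAffine.pow_mem_level (ih hg)
    · rw [Subgroup.mem_comap, map_commutatorElement]
      exact CongruenceAffine.commutator_mem_level hq (ih hg) _

theorem isProPGroup_of_finite {p : ℕ} [Fact p.Prime] [Finite G] [DiscreteTopology G]
    (h : IsPGroup p G) : IsProPGroup p G where
  compactSpace := inferInstance
  t2Space := inferInstance
  totallyDisconnectedSpace := inferInstance
  index_eq N _ _ := h.index N

end TopologicalGroups

/-! ### Free pro-`p` groups, minimal presentations and crossed homomorphisms. -/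

/-- Lifting to finite `p`-groups, in an arbitrary universe. -/
theorem IsFreeProPGroupOn.existsUnique_lift_finite {p : ℕ} [Fact p.Prime] {S : Type v} [Group S]
    [TopologicalSpace S] [IsTopologicalGroup S] {X : Type u} {ι : X → S}
    (h : IsFreeProPGroupOn p ι) {P : Type*} [Group P] [Finite P] (hP : IsPGroup p P)
    (f : X → P) (hf : ∀ᶠ a in cofinite, f a = 1) :
    ∃! φ : S →* P, IsLocallyConstant φ ∧ ∀ a, φ (ι a) = f a := by
  have hsmall : Small.{v} P := Countable.toSmall P
  let E : Shrink.{v} P ≃* P := Shrink.mulEquiv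
  let : TopologicalSpace (Shrink.{v} P) := ⊥
  have : DiscreteTopology (Shrink.{v} P) := ⟨rfl⟩
  have : Finite (Shrink.{v} P) := Finite.of_equiv P E.symm
  have hQ : IsProPGroup p (Shrink.{v} P) := isProPGroup_of_finite (hP.of_equiv E.symm)
  have hf' : ConvergesToOne (fun a => E.symm (f a)) := by
    rw [ConvergesToOne, nhds_discrete]
    exact tendsto_pure.2 (hf.mono fun a ha => by rw [ha, map_one])
  obtain ⟨φ, hφ, huniq⟩ := h.existsUnique_lift _ hQ _ hf'
  refine ⟨E.toMonoidHom.comp φ.toMonoidHom, ⟨?_, fun a => ?_⟩, ?_⟩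
  · exact ((IsLocallyConstant.iff_continuous φ).2 φ.continuous_toFun).comp E
  · change E (φ (ι a)) = f a
    rw [hφ, E.apply_symm_apply]
  · rintro ψ ⟨hψ, hψ'⟩
    let ψ' : S →ₜ* Shrink.{v} P :=
      { E.symm.toMonoidHom.comp ψ with continuous_toFun := (hψ.comp E.symm).continuous }
    have := huniq ψ' fun a => congrArg E.symm (hψ' a)
    ext s
    change ψ s = E (φ s)
    rw [← this]
    exact (E.apply_symm_apply _).symm

theorem ZMod.castHom_eq_zero_iff_dvd {p l : ℕ} [NeZero p] (h : p ∣ p ^ l) (z : ZMod (p ^ l)) :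
    ZMod.castHom h (ZMod p) z = 0 ↔ (p : ZMod (p ^ l)) ∣ z := by
  constructor
  · intro hz
    rw [← ZMod.natCast_zmod_val z, map_natCast, ZMod.natCast_eq_zero_iff] at hz
    rw [← ZMod.natCast_zmod_val z]
    exact Nat.cast_dvd_cast hz
  · rintro ⟨y, rfl⟩
    rw [map_mul, map_natCast, ZMod.natCast_self, zero_mul]

theorem ZMod.castHom_eq_zero_of_pow_mul {p l j : ℕ} [NeZero p] (h : p ∣ p ^ l) (hj : j < l)
    {z : ZMod (p ^ l)} (hz : (p : ZMod (p ^ l)) ^ j * z = 0) :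
    ZMod.castHom h (ZMod p) z = 0 := by
  rw [← ZMod.natCast_zmod_val z, ← Nat.cast_pow, ← Nat.cast_mul, ZMod.natCast_eq_zero_iff] at hz
  rw [← ZMod.natCast_zmod_val z, map_natCast, ZMod.natCast_eq_zero_iff]
  have hz' := (pow_dvd_pow p (Nat.succ_le_of_lt hj)).trans hz
  rw [pow_succ] at hz'
  exact Nat.dvd_of_mul_dvd_mul_left (pow_pos (NeZero.pos p) _) hz'

/-- Every continuous character `G → ℤ/p` is the reduction of a continuous crossed homomorphism
`G → ℤ/p^l` with respect to the action of `G` on `ℤ/p^l` through `c`. -/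
def LiftsCharacters (p l : ℕ) (q : ZMod (p ^ l)) {G : Type*} [Group G] [TopologicalSpace G]
    (c : G →* (ZMod (p ^ l))ˣ) : Prop :=
  ∀ (h : p ∣ p ^ l) (χ : G →* Multiplicative (ZMod p)), IsLocallyConstant χ →
    ∃ κ : G →* CongruenceAffine (ZMod (p ^ l)) q, IsLocallyConstant κ ∧
      (∀ g, (κ g).scale = c g) ∧ ∀ g, ZMod.castHom h (ZMod p) (κ g).shift = (χ g).toAdd

/-- The linear representation attached to a character with values congruent to `1`. -/
def CongruenceAffine.ofScale {A : Type*} [CommRing A] {q : A} {G : Type*} [Group G] (d : G →* Aˣ)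
    (hd : ∀ g, q ∣ (d g : A) - 1) : G →* CongruenceAffine A q :=
  MonoidHom.mk' (fun g => ⟨0, d g, hd g⟩) fun g h => by ext <;> simp

theorem CongruenceAffine.isLocallyConstant {A : Type*} [CommRing A] {q : A} {X : Type*}
    [TopologicalSpace X] {f : X → CongruenceAffine A q}
    (h1 : IsLocallyConstant fun x => (f x).shift) (h2 : IsLocallyConstant fun x => (f x).scale) :
    IsLocallyConstant f :=
  IsLocallyConstant.desc f (fun z => (z.shift, z.scale)) (h1.prodMk h2) fun z w e => by
    ext
    · exact congrArg Prod.fst e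
    · exact congrArg (fun z => ((Prod.snd z : Aˣ) : A)) e

/-- A locally constant homomorphism killing the kernel descends along a minimal presentation. -/
theorem IsMinimalPresentation.exists_descend {p : ℕ} {S : Type*} [Group S] [TopologicalSpace S]
    [IsTopologicalGroup S] [CompactSpace S] {G : Type*} [Group G] [TopologicalSpace G] [T2Space G]
    {π : S →ₜ* G} (hπ : IsMinimalPresentation p π)
    {H : Type*} [Group H] {χ : S →* H} (hχ : IsLocallyConstant χ)
    (hker : π.toMonoidHom.ker ≤ χ.ker) :
    ∃ χ' : G →* H, IsLocallyConstant χ' ∧ ∀ s, χ' (π s) = χ s := by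
  let χ' : G →* H := MonoidHom.liftOfSurjective π.toMonoidHom hπ.surjective ⟨χ, hker⟩
  have h : ∀ s, χ' (π s) = χ s := fun s =>
    MonoidHom.liftOfRightInverse_comp_apply _ _ _ ⟨χ, hker⟩ s
  refine ⟨χ', fun U => ?_, h⟩
  -- A continuous surjection from a compact space to a Hausdorff one is closed, so `G` carries the
  -- quotient topology.
  have hq : IsQuotientMap π :=
    π.continuous_toFun.isClosedMap.isQuotientMap π.continuous_toFun hπ.surjective
  rw [← hq.isOpen_preimage]
  convert hχ U using 1
  ext s
  simp [h]

/-- A crossed homomorphism on a free pro-`p` group may be prescribed on the generators. -/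
theorem IsFreeProPGroupOn.exists_crossedHom {p : ℕ} [Fact p.Prime] {l : ℕ} {q : ZMod (p ^ l)}
    {S : Type*} [Group S] [TopologicalSpace S] [IsTopologicalGroup S] {X : Type*} {ι : X → S}
    (hS : IsFreeProPGroupOn p ι) (hpq : (p : ZMod (p ^ l)) ∣ q)
    {c : S →* (ZMod (p ^ l))ˣ} (hc : IsLocallyConstant c) (hcq : ∀ s, q ∣ (c s : ZMod (p ^ l)) - 1)
    (f : X → ZMod (p ^ l)) (hf : ∀ᶠ a in cofinite, f a = 0) :
    ∃ φ : S →* CongruenceAffine (ZMod (p ^ l)) q, IsLocallyConstant φ ∧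
      (∀ s, (φ s).scale = c s) ∧ ∀ a, (φ (ι a)).shift = f a := by
  have : NeZero (p ^ l) := ⟨pow_ne_zero _ (Fact.out : p.Prime).ne_zero⟩
  have hP : IsPGroup p (CongruenceAffine (ZMod (p ^ l)) q) :=
    CongruenceAffine.isPGroup (by rw [← Nat.cast_pow, ZMod.natCast_self]) hpq
  have hι : ∀ᶠ a in cofinite, c (ι a) = 1 := by
    have h1 : ∀ᶠ s in 𝓝 (1 : S), c s = 1 := by simpa using hc.eventually_eq 1
    exact hS.convergesToOne.eventually h1
  obtain ⟨φ, ⟨hφ, hφι⟩, -⟩ := hS.existsUnique_lift_finite hP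
    (fun a => ⟨f a, c (ι a), hcq _⟩) (by
      filter_upwards [hf, hι] with a h1 h2
      ext <;> simp [h1, h2])
  refine ⟨φ, hφ, fun s => ?_, fun a => by rw [hφι]⟩
  -- The linear part of `φ` is known to be `c` only on generators. Both are recast as maps to the
  -- same finite `p`-group, where lifts are unique.
  have huniq := hS.existsUnique_lift_finite hP (fun a => ⟨0, c (ι a), hcq _⟩) (by
      filter_upwards [hι] with a h2
      ext <;> simp [h2])
  have := huniq.unique (y₁ := CongruenceAffine.ofScale ((CongruenceAffine.scaleHom _ q).comp φ) fun s => (φ s).3)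
    (y₂ := CongruenceAffine.ofScale c hcq)
    ⟨CongruenceAffine.isLocallyConstant (IsLocallyConstant.const 0) (hφ.comp CongruenceAffine.scale), fun a => by
      ext
      · rfl
      · change ((φ (ι a)).scale : ZMod (p ^ l)) = _
        rw [hφι]⟩ ⟨CongruenceAffine.isLocallyConstant (IsLocallyConstant.const 0) hc, fun a => rfl⟩
  exact congrArg CongruenceAffine.scale (DFunLike.congr_fun this s)

/-! ### Lifting of characters as an obstruction to relations. -/

section LiftsCharacters

variable {p : ℕ} [Fact p.Prime] {l : ℕ} {q : ZMod (p ^ l)}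
  {S : Type*} [Group S] [TopologicalSpace S] [IsTopologicalGroup S] [CompactSpace S]
  {G : Type*} [Group G] [TopologicalSpace G] [T2Space G]

/-- Successive approximation of a crossed homomorphism by crossed homomorphisms that factor
through a minimal presentation. -/
theorem LiftsCharacters.exists_dvd_sub {c : G →* (ZMod (p ^ l))ˣ}
    (hG : LiftsCharacters p l q c) (hl : l ≠ 0) (hpq : (p : ZMod (p ^ l)) ∣ q)
    {π : S →ₜ* G} (hπ : IsMinimalPresentation p π)
    {φ : S →* CongruenceAffine (ZMod (p ^ l)) q} (hφ : IsLocallyConstant φ)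
    (hc : ∀ s, (φ s).scale = c (π s)) {j : ℕ} (hj : j ≤ l) :
    ∃ κ : G →* CongruenceAffine (ZMod (p ^ l)) q, IsLocallyConstant κ ∧
      (∀ g, (κ g).scale = c g) ∧
      ∀ s, (p : ZMod (p ^ l)) ^ j ∣ (φ s).shift - (κ (π s)).shift := by
  have hpl : p ∣ p ^ l := dvd_pow_self p hl
  induction j with
  | zero =>
    obtain ⟨κ, h1, h2, -⟩ := hG hpl 1 (IsLocallyConstant.const 1)
    exact ⟨κ, h1, h2, by simp⟩
  | succ j ih =>
    obtain ⟨κ, hκ, hκc, hdvd⟩ := ih (by omega)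
    -- The quotient by `p ^ j` is chosen as a function of the two values, not of `s`, so that it is
    -- locally constant.
    have : ∃ b : CongruenceAffine (ZMod (p ^ l)) q × CongruenceAffine (ZMod (p ^ l)) q →
        ZMod (p ^ l), ∀ s, (φ s).shift - (κ (π s)).shift =
          (p : ZMod (p ^ l)) ^ j * b (φ s, κ (π s)) := by
      classical
      refine ⟨fun z => if h : (p : ZMod (p ^ l)) ^ j ∣ z.1.shift - z.2.shift then h.choose else 0,
        fun s => ?_⟩
      simp only [dif_pos (hdvd s)]
      exact (hdvd s).choose_spec
    obtain ⟨b, hb⟩ := this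
    -- The quotient modulo `p` is well defined since `j < l`, and the crossed relation becomes
    -- additivity since `c ≡ 1` modulo `p`.
    let χ : S →* Multiplicative (ZMod p) := MonoidHom.mk'
      (fun s => Multiplicative.ofAdd (ZMod.castHom hpl (ZMod p) (b (φ s, κ (π s))))) fun s t => by
        rw [← ofAdd_add, Multiplicative.ofAdd.injective.eq_iff, ← sub_eq_zero]
        have h1 : ZMod.castHom hpl (ZMod p) (b (φ (s * t), κ (π (s * t))) -
            (b (φ s, κ (π s)) + c (π s) * b (φ t, κ (π t)))) = 0 := by
          refine ZMod.castHom_eq_zero_of_pow_mul hpl hj ?_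
          have e1 := hb (s * t)
          simp only [map_mul, CongruenceAffine.shift_mul, hc, hκc] at e1
          simp only [map_mul]
          linear_combination -e1 + hb s + c (π s) * hb t
        have h2 : ZMod.castHom hpl (ZMod p) ((c (π s) : ZMod (p ^ l)) - 1) = 0 := by
          rw [ZMod.castHom_eq_zero_iff_dvd, ← hc]
          exact hpq.trans (φ s).3
        simp only [map_sub, map_add, map_mul, map_one] at h1 h2 ⊢
        linear_combination h1 + ZMod.castHom hpl (ZMod p) (b (φ t, κ (π t))) * h2
    have hχ : IsLocallyConstant χ :=
      (hφ.prodMk (hκ.comp_continuous π.continuous_toFun)).comp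
        fun z => Multiplicative.ofAdd (ZMod.castHom hpl (ZMod p) (b z))
    obtain ⟨χ', hχ', hχπ⟩ := hπ.exists_descend hχ
      (hπ.ker_le.trans (frattini_le_ker (fun h => by
        apply Multiplicative.toAdd.injective; simp) hχ))
    obtain ⟨ψ, hψ, hψc, hψχ⟩ := hG hpl χ' hχ'
    -- Correct `κ` by `p ^ j` times a lift of the error character, which removes the error modulo `p
    -- ^ (j + 1)`.
    let κ' : G →* CongruenceAffine (ZMod (p ^ l)) q := MonoidHom.mk'
      (fun g => ⟨(κ g).shift + p ^ j * (ψ g).shift, c g, by rw [← hκc]; exact (κ g).3⟩)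
      fun g h => by
        ext
        · simp only [map_mul, CongruenceAffine.shift_mul, hκc, hψc]; ring
        · simp
    refine ⟨κ', ?_, fun g => rfl, fun s => ?_⟩
    · have : IsLocallyConstant fun g => (κ' g).shift :=
        (hκ.prodMk hψ).comp fun z => z.1.shift + p ^ j * z.2.shift
      have h2 : IsLocallyConstant fun g => (κ' g).scale := by
        have := hκ.comp CongruenceAffine.scale
        convert this using 1
        ext g : 1
        exact (hκc g).symm
      exact CongruenceAffine.isLocallyConstant this h2
    · have h1 : (p : ZMod (p ^ l)) ∣ b (φ s, κ (π s)) - (ψ (π s)).shift := by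
        rw [← ZMod.castHom_eq_zero_iff_dvd hpl, map_sub, hψχ, hχπ]
        exact sub_self _
      have h2 : (φ s).shift - (κ' (π s)).shift =
          p ^ j * (b (φ s, κ (π s)) - (ψ (π s)).shift) := by
        change (φ s).shift - ((κ (π s)).shift + p ^ j * (ψ (π s)).shift) = _
        linear_combination hb s
      rw [h2, pow_succ]
      exact mul_dvd_mul_left _ h1

/-- Crossed homomorphisms factor through minimal presentations. -/
theorem LiftsCharacters.shift_eq_zero {c : G →* (ZMod (p ^ l))ˣ}
    (hG : LiftsCharacters p l q c) (hl : l ≠ 0) (hpq : (p : ZMod (p ^ l)) ∣ q)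
    {π : S →ₜ* G} (hπ : IsMinimalPresentation p π)
    {φ : S →* CongruenceAffine (ZMod (p ^ l)) q} (hφ : IsLocallyConstant φ)
    (hc : ∀ s, (φ s).scale = c (π s)) {r : S} (hr : π r = 1) : (φ r).shift = 0 := by
  obtain ⟨κ, -, -, h⟩ := hG.exists_dvd_sub hl hpq hπ hφ hc le_rfl
  have := h r
  rwa [hr, map_one, CongruenceAffine.shift_one, sub_zero, ← Nat.cast_pow, ZMod.natCast_self,
    zero_dvd_iff] at this

theorem LiftsCharacters.not_exists_relation [IsTopologicalGroup G] {c : G →* (ZMod (p ^ l))ˣ}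
    (hG : LiftsCharacters p l q c) (hl : l ≠ 0) (hc : IsLocallyConstant c)
    (hcq : ∀ g, q ∣ (c g : ZMod (p ^ l)) - 1)
    (hq : (Odd p ∧ (p : ZMod (p ^ l)) ∣ q) ∨ (p = 2 ∧ 4 ∣ q))
    {I : Type*} {x : S} {y : I → S}
    (hS : IsFreeProPGroupOn p (fun o : Option I => o.elim x y))
    {π : S →ₜ* G} (hπ : IsMinimalPresentation p π) {u : ℤ} (hu : Int.gcd p u = 1) {s t : S}
    (hs : s ∈ closedCommutator (Subgroup.closure (Set.range y)).topologicalClosure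
      (Subgroup.closure (Set.range y)).topologicalClosure)
    (ht : t ∈ pDescendingCentralSeries p S (l + 1)) :
    π (x ^ ((p : ℤ) ^ (l - 1) * u) * s * t) ≠ 1 := by
  intro hr
  have hpq : (p : ZMod (p ^ l)) ∣ q := by
    rcases hq with h | ⟨rfl, h⟩
    · exact h.2
    · exact Dvd.dvd.trans ⟨2, by norm_num⟩ h
  have hpl : (p : ZMod (p ^ l)) ^ l = 0 := by rw [← Nat.cast_pow, ZMod.natCast_self]
  obtain ⟨φ, hφ, hφc, hφι⟩ := hS.exists_crossedHom hpq
    (c := c.comp π.toMonoidHom) (hc.comp_continuous π.continuous_toFun) (fun s => hcq _)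
    (fun o => o.elim 1 fun _ => 0) (by
      refine (Set.finite_singleton (none : Option I)).subset fun o ho => ?_
      cases o
      · rfl
      · exact absurd rfl ho)
  have hx : (φ x).shift = 1 := hφι none
  have hy : ∀ i, (φ (y i)).shift = 0 := fun i => hφι (some i)
  let L := (CongruenceAffine.linear (ZMod (p ^ l)) q).comap φ
  have hLc : IsClosed (L : Set S) := φ.isClosed_comap_of_isLocallyConstant hφ _
  have hT : (Subgroup.closure (Set.range y)).topologicalClosure ≤ L :=
    Subgroup.topologicalClosure_minimal _
      ((Subgroup.closure_le _).2 (by rintro _ ⟨i, rfl⟩; exact hy i)) hLc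
  have hsL : s ∈ L := closedCommutator_le hLc
    ((Subgroup.commutator_mono hT hT).trans (Subgroup.commutator_le_self L)) hs
  have htL : t ∈ L := by
    have h1 := (pDescendingCentralSeries_le_level hpq hφ l ht).1
    rwa [hpl, zero_dvd_iff] at h1
  have hrL : x ^ ((p : ℤ) ^ (l - 1) * u) * s * t ∈ L :=
    hG.shift_eq_zero hl hpq hπ hφ hφc hr
  have hxuL : (x ^ p ^ (l - 1)) ^ u ∈ L := by
    have h1 := (L.mul_mem_cancel_right hsL).1 ((L.mul_mem_cancel_right htL).1 hrL)
    rw [zpow_mul] at h1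
    exact_mod_cast h1
  -- As `p` and `u` are coprime, membership of the `p`-th and `u`-th powers in the subgroup `L`
  -- gives that of `x ^ p ^ (l - 1)` itself.
  have hxpL : (x ^ p ^ (l - 1)) ^ (p : ℤ) ∈ L := by
    rw [zpow_natCast, ← pow_mul, ← pow_succ, Nat.sub_add_cancel (Nat.one_le_iff_ne_zero.2 hl)]
    obtain ⟨e, he⟩ := CongruenceAffine.exists_shift_pow_eq hq (φ x) l
    change (φ (x ^ p ^ l)).shift = 0
    rw [map_pow, he, hpl, zero_mul, zero_mul]
  have hxL : x ^ p ^ (l - 1) ∈ L := by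
    have h1 := Int.gcd_eq_gcd_ab p u
    rw [hu, Nat.cast_one] at h1
    have h2 : x ^ p ^ (l - 1) = ((x ^ p ^ (l - 1)) ^ (p : ℤ)) ^ Int.gcdA p u *
        ((x ^ p ^ (l - 1)) ^ u) ^ Int.gcdB p u := by
      rw [← zpow_mul, ← zpow_mul, ← zpow_add, ← h1, zpow_one]
    rw [h2]
    exact L.mul_mem (L.zpow_mem hxpL _) (L.zpow_mem hxuL _)
  obtain ⟨e, he⟩ := CongruenceAffine.exists_shift_pow_eq hq (φ x) (l - 1)
  have h0 : (p : ZMod (p ^ l)) ^ (l - 1) * (1 + p * e) = 0 := by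
    rw [hx, mul_one] at he
    rw [← he, ← map_pow]
    exact hxL
  have h1 := ZMod.castHom_eq_zero_of_pow_mul (dvd_pow_self p hl) (by omega) h0
  rw [map_add, map_mul, map_one, map_natCast, ZMod.natCast_self, zero_mul, add_zero] at h1
  exact one_ne_zero h1

end LiftsCharacters

/-! ### Kummer theory. -/

theorem AddChar.zmodChar_injective {K : Type*} [Field K] {n : ℕ} [NeZero n] {ζ : K}
    (h : IsPrimitiveRoot ζ n) : Function.Injective (AddChar.zmodChar n h.pow_eq_one) := by
  intro a b hab
  rw [AddChar.zmodChar_apply, AddChar.zmodChar_apply] at hab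
  exact ZMod.val_injective n (h.pow_inj a.val_lt b.val_lt hab)

section Kummer

variable {F K : Type*} [Field F] [Field K] [Algebra F K]

theorem IsPrimitiveRoot.map_zmodChar {n : ℕ} [NeZero n] {ζ : K} (h : IsPrimitiveRoot ζ n)
    (σ : Gal(K/F)) (a : ZMod n) :
    σ (AddChar.zmodChar n h.pow_eq_one a) =
      AddChar.zmodChar n h.pow_eq_one (h.autToPow F σ * a) := by
  rw [← ZMod.natCast_zmod_val a, AddChar.zmodChar_apply', map_pow, ← h.autToPow_spec F σ,
    ← pow_mul]
  conv_rhs => rw [← ZMod.natCast_zmod_val (h.autToPow F σ : ZMod n), ← Nat.cast_mul]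
  rw [AddChar.zmodChar_apply']

/-- Kummer theory: a continuous character of order dividing `p` is given by a radical. -/
theorem exists_eigenvector_of_character [IsGalois F K] {p : ℕ} [Fact p.Prime] {ξ : K}
    (hξ : IsPrimitiveRoot ξ p) (hfix : ∀ σ : Gal(K/F), σ ξ = ξ)
    {χ : Gal(K/F) →* Multiplicative (ZMod p)} (hχ : IsLocallyConstant χ) :
    ∃ γ : K, γ ≠ 0 ∧ ∀ σ, σ γ = AddChar.zmodChar p hξ.pow_eq_one (χ σ).toAdd * γ := by
  by_cases htriv : ∀ σ, χ σ = 1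
  · exact ⟨1, one_ne_zero, fun σ => by simp [htriv]⟩
  push Not at htriv
  obtain ⟨τ, hτ⟩ := htriv
  let E := AddChar.zmodChar p hξ.pow_eq_one
  have hE : ∀ (σ : Gal(K/F)) a, σ (E a) = E a := fun σ a => by
    simp only [E, AddChar.zmodChar_apply, map_pow, hfix]
  have hsurj : ∀ a : ZMod p, ∃ σ, (χ σ).toAdd = a := fun a => by
    have h0 : (χ τ).toAdd ≠ 0 := fun h => hτ (Multiplicative.toAdd.injective h)
    refine ⟨τ ^ (a * (χ τ).toAdd⁻¹).val, ?_⟩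
    rw [map_pow, toAdd_pow, nsmul_eq_mul, ZMod.natCast_zmod_val, mul_assoc, inv_mul_cancel₀ h0,
      mul_one]
  choose s hs using hsurj
  have hclosed : IsClosed (χ.ker : Set Gal(K/F)) :=
    χ.isClosed_comap_of_isLocallyConstant hχ ⊥
  -- The restrictions to `L` of the `s a` are distinct, so Dedekind independence yields a nonzero
  -- Lagrange resolvent, the required eigenvector.
  let L : IntermediateField F K := IntermediateField.fixedField χ.ker
  have hL : L.fixingSubgroup = χ.ker :=
    InfiniteGalois.fixingSubgroup_fixedField (⟨χ.ker, hclosed⟩ : ClosedSubgroup Gal(K/F))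
  let v : ZMod p → (L →* K) := fun a => ((s a : K →* K)).comp (L.val : L →* K)
  have hv : Function.Injective v := fun a b hab => by
    have h1 : (s b)⁻¹ * s a ∈ L.fixingSubgroup := by
      rw [IntermediateField.mem_fixingSubgroup_iff]
      intro θ hθ
      have : s a θ = s b θ := DFunLike.congr_fun hab (⟨θ, hθ⟩ : L)
      rw [AlgEquiv.mul_apply, this, ← AlgEquiv.mul_apply, inv_mul_cancel, AlgEquiv.one_apply]
    rw [hL, MonoidHom.mem_ker, map_mul, map_inv, inv_mul_eq_one] at h1
    rw [← hs a, ← hs b, h1]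
  have hind := (linearIndependent_monoidHom L K).comp v hv
  rw [Fintype.linearIndependent_iff] at hind
  have hex : ∃ θ : L, ∑ a, E (-a) * s a θ ≠ 0 := by
    by_contra! hcon
    have := hind (fun a => E (-a)) (by
      ext θ
      simpa [Finset.sum_apply, v] using hcon θ) 0
    simp at this
  obtain ⟨θ, hθ⟩ := hex
  refine ⟨_, hθ, fun σ => ?_⟩
  have hmul : ∀ a, σ (s a θ) = s (a + (χ σ).toAdd) θ := fun a => by
    have h1 : (s (a + (χ σ).toAdd))⁻¹ * (σ * s a) ∈ L.fixingSubgroup := by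
      rw [hL, MonoidHom.mem_ker, map_mul, map_mul, map_inv, inv_mul_eq_one]
      apply Multiplicative.toAdd.injective
      rw [hs, toAdd_mul, hs, add_comm]
    have h2 := (IntermediateField.mem_fixingSubgroup_iff _ _).1 h1 θ θ.2
    have h3 := congrArg (s (a + (χ σ).toAdd)) h2
    rwa [← AlgEquiv.mul_apply, mul_inv_cancel_left, AlgEquiv.mul_apply] at h3
  rw [map_sum, Finset.mul_sum]
  refine Fintype.sum_equiv (Equiv.addRight (χ σ).toAdd) _ _ fun a => ?_
  rw [map_mul, hE, hmul, Equiv.coe_addRight, ← mul_assoc]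
  change _ = E _ * E _ * _
  rw [← AddChar.map_add_eq_mul]
  congr 2
  ring

/-- The Galois action on the radical `α` and on the roots of unity. -/
theorem exists_kummerHom [Algebra.IsIntegral F K] {n : ℕ} [NeZero n] {ζ : K}
    (hζ : IsPrimitiveRoot ζ n) {q : ZMod n}
    (hq : ∀ σ : Gal(K/F), q ∣ (hζ.autToPow F σ : ZMod n) - 1) {α : K} (hα : α ≠ 0)
    (hfix : ∀ σ : Gal(K/F), σ (α ^ n) = α ^ n) :
    ∃ κ : Gal(K/F) →* CongruenceAffine (ZMod n) q, IsLocallyConstant κ ∧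
      (∀ σ, (κ σ).scale = hζ.autToPow F σ) ∧
      ∀ σ, σ α = AddChar.zmodChar n hζ.pow_eq_one (κ σ).shift * α := by
  have hinj := AddChar.zmodChar_injective hζ
  have hb : ∀ σ : Gal(K/F), ∃ b, AddChar.zmodChar n hζ.pow_eq_one b * α = σ α := fun σ => by
    have h1 : (σ α / α) ^ n = 1 := by
      rw [div_pow, ← map_pow, hfix, div_self (pow_ne_zero _ hα)]
    obtain ⟨i, -, hi⟩ := hζ.eq_pow_of_pow_eq_one h1
    exact ⟨i, by rw [AddChar.zmodChar_apply', hi, div_mul_cancel₀ _ hα]⟩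
  choose b hb using hb
  let κ : Gal(K/F) →* CongruenceAffine (ZMod n) q := MonoidHom.mk'
    (fun σ => ⟨b σ, hζ.autToPow F σ, hq σ⟩) fun σ τ => by
      ext
      · apply hinj
        apply mul_right_cancel₀ hα
        rw [hb, AlgEquiv.mul_apply, ← hb τ, map_mul, ← hb σ, hζ.map_zmodChar,
          CongruenceAffine.shift_mul, AddChar.map_add_eq_mul]
        ring
      · simp
  refine ⟨κ, κ.isLocallyConstant_of_isOpen_ker ?_, fun σ => rfl, fun σ => (hb σ).symm⟩
  refine Subgroup.isOpen_mono (H₁ := MulAction.stabilizer Gal(K/F) ζ ⊓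
    MulAction.stabilizer Gal(K/F) α) ?_ ?_
  · rintro σ ⟨h1, h2⟩
    have h1 : σ ζ = ζ := h1
    have h2 : σ α = α := h2
    rw [MonoidHom.mem_ker]
    ext
    · apply hinj
      apply mul_right_cancel₀ hα
      change AddChar.zmodChar n hζ.pow_eq_one (b σ) * α = AddChar.zmodChar n hζ.pow_eq_one 0 * α
      rw [hb, AddChar.map_zero_eq_one, h2, one_mul]
    · apply hinj
      change AddChar.zmodChar n _ (hζ.autToPow F σ : ZMod n) = AddChar.zmodChar n _ 1
      rw [← mul_one (hζ.autToPow F σ : ZMod n), ← hζ.map_zmodChar]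
      rw [← Nat.cast_one, AddChar.zmodChar_apply', map_pow, h1]
  · exact (stabilizer_isOpen_of_isIntegral ζ).inter (stabilizer_isOpen_of_isIntegral α)

end Kummer

/-! ### The maximal pro-`p` quotient. -/

section ProPQuotient

variable {p : ℕ} {Γ : Type*} [Group Γ] [TopologicalSpace Γ]

theorem isClosed_proPKernel [IsTopologicalGroup Γ] : IsClosed (proPKernel p Γ : Set Γ) := by
  rw [proPKernel, Subgroup.coe_sInf]
  exact isClosed_biInter fun N hN => Subgroup.isClosed_of_isOpen N hN.2.1

/-- Locally constant homomorphisms to finite `p`-groups descend to the maximal pro-`p` quotient. -/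
theorem MaximalProPQuotient.exists_descend [Fact p.Prime] {H : Type*} [Group H] [Finite H]
    (hH : IsPGroup p H) {f : Γ →* H} (hf : IsLocallyConstant f) :
    ∃ f' : MaximalProPQuotient p Γ →* H, IsLocallyConstant f' ∧
      ∀ σ : Γ, f' (QuotientGroup.mk σ) = f σ := by
  have hker : proPKernel p Γ ≤ f.ker := by
    refine sInf_le ⟨inferInstance, hf {1}, ?_⟩
    rw [Subgroup.index_ker]
    exact IsPGroup.iff_card.1 (hH.to_subgroup f.range)
  refine ⟨QuotientGroup.lift _ f hker, fun U => ?_, fun σ => rfl⟩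
  exact isOpen_coinduced.2 (hf U)

end ProPQuotient

/-! ### The cyclotomic character and lifting of Galois characters. -/

section Galois

variable {F K : Type*} [Field F] [Field K] [Algebra F K]

theorem exists_isPrimitiveRoot_pow_eq [IsSepClosed K] {p e l : ℕ} [Fact p.Prime] (he : e ≠ 0)
    (hel : e ≤ l) (hp : (p : K) ≠ 0) {z : K} (hz : IsPrimitiveRoot z (p ^ e)) :
    ∃ ζ : K, IsPrimitiveRoot ζ (p ^ l) ∧ ζ ^ p ^ (l - e) = z := by
  have : NeZero ((p ^ (l - e) : ℕ) : K) := ⟨by rw [Nat.cast_pow]; exact pow_ne_zero _ hp⟩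
  obtain ⟨ζ, hζ⟩ := IsSepClosed.exists_pow_nat_eq z (p ^ (l - e))
  refine ⟨ζ, ?_, hζ⟩
  obtain ⟨d, rfl⟩ := Nat.exists_eq_succ_of_ne_zero he
  obtain ⟨m, rfl⟩ := Nat.exists_eq_add_of_le hel
  have hm : d.succ + m - d.succ = m := by omega
  rw [hm] at hζ
  rw [show d.succ + m = (d + m) + 1 by omega, IsPrimitiveRoot.iff_orderOf]
  refine orderOf_eq_prime_pow (fun h => ?_) ?_
  · rw [add_comm, pow_add, pow_mul, hζ] at h
    have := Nat.le_of_dvd (pow_pos (Fact.out : p.Prime).pos d) (hz.dvd_of_pow_eq_one _ h)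
    exact absurd this (not_le.2 (pow_lt_pow_right₀ (Fact.out : p.Prime).one_lt d.lt_succ_self))
  · rw [show d + m + 1 = m + d.succ by omega, pow_add, pow_mul, hζ, hz.pow_eq_one]

/-- An automorphism fixing the `p ^ e`-th roots of unity raises them to a power congruent to `1`
modulo `p ^ e`. -/
theorem pow_dvd_autToPow_sub_one {p e l : ℕ} [Fact p.Prime] (hel : e ≤ l) {ζ : K}
    (hζ : IsPrimitiveRoot ζ (p ^ l)) (σ : Gal(K/F))
    (hσ : σ (ζ ^ p ^ (l - e)) = ζ ^ p ^ (l - e)) :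
    (p : ZMod (p ^ l)) ^ e ∣ (hζ.autToPow F σ : ZMod (p ^ l)) - 1 := by
  have hp : p.Prime := Fact.out
  set k := ((hζ.autToPow F σ : ZMod (p ^ l))).val
  have hz : IsPrimitiveRoot (ζ ^ p ^ (l - e)) (p ^ e) :=
    hζ.pow (pow_pos hp.pos _) (by rw [← pow_add, Nat.sub_add_cancel hel])
  have hk : ζ ^ k = σ ζ := hζ.autToPow_spec F σ
  have h1 : (ζ ^ p ^ (l - e)) ^ k = (ζ ^ p ^ (l - e)) ^ 1 := by
    rw [pow_one, ← pow_mul, mul_comm, pow_mul, hk, ← map_pow, hσ]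
  rw [(hz.isOfFinOrder (pow_pos hp.pos _).ne').pow_eq_pow_iff_modEq, ← hz.eq_orderOf] at h1
  have h2 := map_dvd (Int.castRingHom (ZMod (p ^ l))) (Nat.modEq_iff_dvd.1 h1.symm)
  have h3 : ((k : ℕ) : ZMod (p ^ l)) = hζ.autToPow F σ := ZMod.natCast_zmod_val _
  rw [← h3]
  simpa using h2

/-- If `γ` is a radical for `χ` and `α ^ p ^ (l - 1) = γ`, then `σ α / α` is a `p ^ l`-th root of
unity whose `p ^ (l - 1)`-th power is `σ γ / γ`. Its exponent is the lift; it descends to the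
pro-`p` quotient because the affine group is a finite `p`-group. -/
theorem liftsCharacters_autToPow [IsGalois F K] [IsSepClosed K] {p l : ℕ} [Fact p.Prime]
    (hl : l ≠ 0) (hp : (p : K) ≠ 0) {ζ : K} (hζ : IsPrimitiveRoot ζ (p ^ l))
    (hfix : ∀ σ : Gal(K/F), σ (ζ ^ p ^ (l - 1)) = ζ ^ p ^ (l - 1)) {q : ZMod (p ^ l)}
    (hpq : (p : ZMod (p ^ l)) ∣ q)
    (hq : ∀ σ : Gal(K/F), q ∣ (hζ.autToPow F σ : ZMod (p ^ l)) - 1)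
    {c : MaximalProPQuotient p Gal(K/F) →* (ZMod (p ^ l))ˣ}
    (hc : ∀ σ : Gal(K/F), c (QuotientGroup.mk σ) = hζ.autToPow F σ) :
    LiftsCharacters p l q c := by
  intro hpl χ hχ
  have hl1 : l - 1 + 1 = l := Nat.sub_add_cancel (Nat.one_le_iff_ne_zero.2 hl)
  have hξ : IsPrimitiveRoot (ζ ^ p ^ (l - 1)) p :=
    hζ.pow (pow_pos (Fact.out : p.Prime).pos _) (by rw [← pow_succ, hl1])
  obtain ⟨γ, hγ0, hγ⟩ := exists_eigenvector_of_character hξ hfix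
    (χ := χ.comp (QuotientGroup.mk' _)) (hχ.comp_continuous continuous_quotient_mk')
  have : NeZero ((p ^ (l - 1) : ℕ) : K) := ⟨by rw [Nat.cast_pow]; exact pow_ne_zero _ hp⟩
  obtain ⟨α, hα⟩ := IsSepClosed.exists_pow_nat_eq γ (p ^ (l - 1))
  have hα0 : α ≠ 0 := by
    rintro rfl
    exact hγ0 (by rw [← hα, zero_pow (pow_ne_zero _ (Fact.out : p.Prime).ne_zero)])
  have hαn : α ^ p ^ l = γ ^ p := by rw [← hα, ← pow_mul, ← pow_succ, hl1]
  obtain ⟨κ, hκ, hκc, hκα⟩ := exists_kummerHom hζ hq hα0 fun σ => by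
    rw [hαn, map_pow, hγ, mul_pow, AddChar.zmodChar_apply, ← pow_mul, mul_comm _ p, pow_mul,
      hξ.pow_eq_one, one_pow, one_mul]
  obtain ⟨κ', hκ', hκκ⟩ := MaximalProPQuotient.exists_descend
    (CongruenceAffine.isPGroup (by rw [← Nat.cast_pow, ZMod.natCast_self]) hpq) hκ
  refine ⟨κ', hκ', fun g => ?_, fun g => ?_⟩
  · obtain ⟨σ, rfl⟩ := QuotientGroup.mk_surjective g
    rw [hκκ, hκc, hc]
  · obtain ⟨σ, rfl⟩ := QuotientGroup.mk_surjective g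
    apply AddChar.zmodChar_injective hξ
    apply mul_right_cancel₀ hγ0
    refine Eq.trans ?_ (hγ σ)
    rw [hκκ, ← ZMod.natCast_zmod_val (κ σ).shift, map_natCast, AddChar.zmodChar_apply', ← hα,
      map_pow, hκα, AddChar.zmodChar_apply, mul_pow, ← pow_mul, ← pow_mul, mul_comm (p ^ _)]

end Galois

/-! ### The theorem. -/

theorem theorem3p9 (p : ℕ) [Fact p.Prime] (F : Type*) [Field F]
    (hF : RootsOfUnityCondition p F)
    (S : Type*) [Group S] [TopologicalSpace S] [IsTopologicalGroup S]
    (I : Type*) (x : S) (y : I → S)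
    (hS : IsFreeProPGroupOn p (fun o : Option I => o.elim x y))
    (π : S →ₜ* maximalProPGaloisGroup p F) (hπ : IsMinimalPresentation p π)
    (T : Subgroup S) (hT : T = (Subgroup.closure (Set.range y)).topologicalClosure) :
    ¬ ∃ (l : ℕ) (u : ℤ) (s t : S), 2 ≤ l ∧ Int.gcd p u = 1 ∧
      s ∈ closedCommutator T T ∧
      t ∈ pDescendingCentralSeries p S (l + 1) ⊓ closedCommutator ⊤ ⊤ ∧
      π (x ^ ((p : ℤ) ^ (l - 1) * u) * s * t) = 1 := by
  rintro ⟨l, u, s, t, hl, hu, hs, ht, hr⟩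
  subst hT
  have hpr : p.Prime := Fact.out
  -- Take `e = 2` if `p = 2` (allowed since `2 ≤ l`) and `e = 1` otherwise; the modulus is `q = p ^
  -- e`.
  obtain ⟨e, he, hel, z, hz, hq⟩ : ∃ e, e ≠ 0 ∧ e ≤ l ∧ ∃ z : F, IsPrimitiveRoot z (p ^ e) ∧
      ((Odd p ∧ (p : ZMod (p ^ l)) ∣ (p : ZMod (p ^ l)) ^ e) ∨
        (p = 2 ∧ 4 ∣ (p : ZMod (p ^ l)) ^ e)) := by
    by_cases h2 : p = 2
    · obtain ⟨z, hz⟩ := hF.2 h2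
      exact ⟨2, two_ne_zero, hl, z, by rw [h2]; exact hz, Or.inr ⟨h2, by rw [h2]; norm_num⟩⟩
    · obtain ⟨z, hz⟩ := hF.1 h2
      exact ⟨1, one_ne_zero, by omega, z, by rwa [pow_one],
        Or.inl ⟨hpr.odd_of_ne_two h2, by rw [pow_one]⟩⟩
  let K := SeparableClosure F
  have hp : (p : K) ≠ 0 := by
    have h1 := (hz.map_of_injective (algebraMap F K).injective).neZero'.out
    rw [Nat.cast_pow] at h1
    exact ne_zero_pow he h1
  obtain ⟨ζ, hζ, hζz⟩ := exists_isPrimitiveRoot_pow_eq he hel hp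
    (hz.map_of_injective (algebraMap F K).injective)
  have hfix : ∀ σ : Gal(K/F), σ (ζ ^ p ^ (l - e)) = ζ ^ p ^ (l - e) := fun σ => by
    rw [hζz, AlgEquiv.commutes]
  have hfix1 : ∀ σ : Gal(K/F), σ (ζ ^ p ^ (l - 1)) = ζ ^ p ^ (l - 1) := fun σ => by
    have h1 : l - 1 = (l - e) + (e - 1) := by omega
    rw [h1, pow_add, pow_mul, map_pow, hfix]
  have hpq : (p : ZMod (p ^ l)) ∣ (p : ZMod (p ^ l)) ^ e := dvd_pow_self _ he
  have hdvd := fun σ : Gal(K/F) => pow_dvd_autToPow_sub_one hel hζ σ (hfix σ)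
  -- The radical `1` has trivial cocycle: `κ` only serves to make the cyclotomic character locally
  -- constant and descend it to `G_F(p)`.
  obtain ⟨κ, hκ, hκc, -⟩ := exists_kummerHom hζ hdvd one_ne_zero (by simp)
  obtain ⟨κ', hκ', hκκ⟩ := MaximalProPQuotient.exists_descend
    (CongruenceAffine.isPGroup (by rw [← Nat.cast_pow, ZMod.natCast_self]) hpq) hκ
  have hlift : LiftsCharacters p l _ ((CongruenceAffine.scaleHom _ _).comp κ') :=
    liftsCharacters_autToPow (by omega) hp hζ hfix1 hpq hdvd fun σ => by
      rw [MonoidHom.comp_apply, hκκ, CongruenceAffine.scaleHom_apply, hκc]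
  have := hS.isProPGroup.compactSpace
  have : IsClosed (proPKernel p Gal(K/F) : Set Gal(K/F)) := isClosed_proPKernel
  exact hlift.not_exists_relation (by omega) (hκ'.comp CongruenceAffine.scale)
    (fun g => (κ' g).3) hq hS hπ hu hs ht.1 hr
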